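/- Let $K$ be a field and $n\in\mathbb N$. Let $H_n^{(0)}$ be the nilHecke algebra of type $A$: the unital associative $K$-algebra generated by $\psi_1,\dots,\psi_{n-1},y_1,\dots,y_n$ subject to the relations $$\psi_r^2=0,\qquad \psi_r\psi_k=\psi_k\psi_r\ (k<r-1),\qquad \psi_r\psi_{r+1}\psi_r=\psi_{r+1}\psi_r\psi_{r+1},\qquad y_ry_k=y_ky_r,$$ $$\psi_r y_{r+1}=y_r\psi_r+1,\qquad y_{r+1}\psi_r=\psi_r y_r+1,\qquad \psi_r y_k=y_k\psi_r\ (k\neq r,r+1).$$ For $w$ in the symmetric group $\mathfrak S_n$ put $\psi_w:=\psi_{i_1}\cdots\psi_{i_k}$, where $w=s_{i_1}\cdots s_{i_k}$ is a reduced expression in the simple transpositions $s_i=(i,i+1)$ (the choice does not matter), let $w_0$ be the longest element of $\mathfrak S_n$, and let $J_n:=\sum_{s=1}^{n-1}\psi_sH_n^{(0)}$. Let $\lambda=(\lambda_1\ge\lambda_2\ge\cdots\ge\lambda_n\ge 0)$ be a partition with at most $n$ parts, let $\delta:=(n-1,n-2,\dots,0)$, and put $$S_\lambda:=(-1)^{n(n-1)/2}\,y_1^{\lambda_1+n-1}y_2^{\lambda_2+n-2}\cdots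 y_n^{\lambda_n}\,\psi_{w_0}\in H_n^{(0)}.$$ Then there is a unique symmetric polynomial $p\in K[x_1,\dots,x_n]$ with $S_\lambda\equiv p(y_1,\dots,y_n)\bmod J_n$, and the element $z(\lambda):=p(y_1,\dots,y_n)$ of $H_n^{(0)}$ satisfies $$z(\lambda)=s_\lambda(y_1,\dots,y_n),$$ where $s_\lambda:=a_{\lambda+\delta}/a_\delta\in K[x_1,\dots,x_n]$, with $a_\mu:=\sum_{w\in\mathfrak S_n}(-1)^{\ell(w)}x^{w(\mu)}$ and $\ell(w)$ the length of $w$, is the Schur polynomial of $\lambda$. -/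

import Mathlib

noncomputable section

namespace NilHeckeAlg

/-! All indices start at `0`: the generators `y_1, …, y_n` are indexed by `Fin n`, the generators
`ψ_1, …, ψ_{n-1}` by `Fin (n - 1)`. -/

/-- The position `r` of the pair `(r, r + 1)`. -/
def lo {n : ℕ} (r : Fin (n - 1)) : Fin n := ⟨r.1, by omega⟩

/-- The position `r + 1` of the pair `(r, r + 1)`. -/
def hi {n : ℕ} (r : Fin (n - 1)) : Fin n := ⟨r.1 + 1, by omega⟩

section Permutations

/-- The simple transposition `s_r = (r, r + 1)`. -/
def simpleRefl {n : ℕ} (r : Fin (n - 1)) : Equiv.Perm (Fin n) := Equiv.swap (lo r) (hi r)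

/-- `I` is an expression of `w` as a product of simple transpositions. -/
def IsExpr {n : ℕ} (w : Equiv.Perm (Fin n)) (I : List (Fin (n - 1))) : Prop :=
  (I.map simpleRefl).prod = w

/-- `I` is a reduced expression of `w`: no expression of `w` is shorter. -/
def IsReducedExpr {n : ℕ} (w : Equiv.Perm (Fin n)) (I : List (Fin (n - 1))) : Prop :=
  IsExpr w I ∧ ∀ I', IsExpr w I' → I.length ≤ I'.length

theorem exists_isExpr {n : ℕ} (w : Equiv.Perm (Fin n)) : ∃ I, IsExpr w I := by
  cases n with
  | zero => exact ⟨[], Subsingleton.elim _ _⟩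
  | succ n =>
    have hw : w ∈ Submonoid.closure
        (Set.range fun i : Fin n ↦ Equiv.swap i.castSucc i.succ) := by
      rw [Equiv.Perm.mclosure_swap_castSucc_succ]; trivial
    induction hw using Submonoid.closure_induction with
    | mem x hx =>
      obtain ⟨i, rfl⟩ := hx
      exact ⟨[i], by simp [IsExpr, simpleRefl, lo, hi]; rfl⟩
    | one => exact ⟨[], rfl⟩
    | mul x y _ _ hx hy =>
      obtain ⟨I, hI⟩ := hx
      obtain ⟨I', hI'⟩ := hy
      refine ⟨I ++ I', ?_⟩
      unfold IsExpr at *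
      rw [List.map_append, List.prod_append, hI, hI']

theorem exists_isReducedExpr {n : ℕ} (w : Equiv.Perm (Fin n)) : ∃ I, IsReducedExpr w I := by
  classical
  have h : ∃ k, ∃ I, IsExpr w I ∧ I.length = k := by
    obtain ⟨I, hI⟩ := exists_isExpr w
    exact ⟨_, I, hI, rfl⟩
  obtain ⟨I, hI, hl⟩ := Nat.find_spec h
  exact ⟨I, hI, fun I' hI' ↦ hl ▸ Nat.find_min' h ⟨I', hI', rfl⟩⟩

/-- The longest element `w_{0,n}` of the symmetric group: `i ↦ n + 1 - i` in `1`-based indices. -/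
def longest (n : ℕ) : Equiv.Perm (Fin n) := Fin.revPerm

end Permutations

section Algebra

variable (K : Type*) [Field K] (n : ℕ)

/-- The free generator `ψ_r`. -/
def freePsi (r : Fin (n - 1)) : FreeAlgebra K (Fin (n - 1) ⊕ Fin n) := FreeAlgebra.ι K (Sum.inl r)

/-- The free generator `y_k`. -/
def freeY (k : Fin n) : FreeAlgebra K (Fin (n - 1) ⊕ Fin n) := FreeAlgebra.ι K (Sum.inr k)

/-- The defining relations of the nilHecke algebra of type `A`. -/
inductive Rel :
    FreeAlgebra K (Fin (n - 1) ⊕ Fin n) → FreeAlgebra K (Fin (n - 1) ⊕ Fin n) → Prop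
  | psi_sq (r : Fin (n - 1)) : Rel (freePsi K n r * freePsi K n r) 0
  | psi_comm (r k : Fin (n - 1)) (h : k.1 + 1 < r.1) :
      Rel (freePsi K n r * freePsi K n k) (freePsi K n k * freePsi K n r)
  | braid (r t : Fin (n - 1)) (h : t.1 = r.1 + 1) :
      Rel (freePsi K n r * freePsi K n t * freePsi K n r)
        (freePsi K n t * freePsi K n r * freePsi K n t)
  | y_comm (r k : Fin n) : Rel (freeY K n r * freeY K n k) (freeY K n k * freeY K n r)
  | psi_y (r : Fin (n - 1)) :
      Rel (freePsi K n r * freeY K n (hi r)) (freeY K n (lo r) * freePsi K n r + 1)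
  | y_psi (r : Fin (n - 1)) :
      Rel (freeY K n (hi r) * freePsi K n r) (freePsi K n r * freeY K n (lo r) + 1)
  | psi_y_comm (r : Fin (n - 1)) (k : Fin n) (h₁ : k ≠ lo r) (h₂ : k ≠ hi r) :
      Rel (freePsi K n r * freeY K n k) (freeY K n k * freePsi K n r)

/-- The nilHecke algebra `H_n^{(0)}(K)` of type `A`. -/
def NilHecke : Type _ := RingQuot (Rel K n)

instance : Ring (NilHecke K n) := inferInstanceAs (Ring (RingQuot (Rel K n)))

instance : Algebra K (NilHecke K n) := inferInstanceAs (Algebra K (RingQuot (Rel K n)))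

/-- The quotient map from the free algebra. -/
def mkHom : FreeAlgebra K (Fin (n - 1) ⊕ Fin n) →ₐ[K] NilHecke K n :=
  RingQuot.mkAlgHom K (Rel K n)

/-- The generator `ψ_r` of the nilHecke algebra. -/
def psi (r : Fin (n - 1)) : NilHecke K n := mkHom K n (freePsi K n r)

/-- The generator `y_k` of the nilHecke algebra. -/
def y (k : Fin n) : NilHecke K n := mkHom K n (freeY K n k)

/-- `ψ_w = ψ_{i_1} ⋯ ψ_{i_k}` for a reduced expression `w = s_{i_1} ⋯ s_{i_k}`
(by the braid relations it does not matter which one is chosen). -/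
def psiPerm (w : Equiv.Perm (Fin n)) : NilHecke K n :=
  ((exists_isReducedExpr w).choose.map (psi K n)).prod

/-- The monomial `y^c = y_1^{c_1} ⋯ y_n^{c_n}`. -/
def yMonomial (c : Fin n → ℕ) : NilHecke K n := (List.ofFn fun i ↦ y K n i ^ c i).prod

/-- The value `f(y_1, …, y_n)` of a polynomial `f` at the commuting elements `y_1, …, y_n`. -/
def evalY (f : MvPolynomial (Fin n) K) : NilHecke K n :=
  ∑ m ∈ f.support, f.coeff m • yMonomial K n m

/-- The right ideal `J_n = ∑_s ψ_s H_n^{(0)}`, as a subspace. -/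
def J : Submodule K (NilHecke K n) :=
  ⨆ r : Fin (n - 1), LinearMap.range (LinearMap.mulLeft K (psi K n r))

/-- `δ = (n - 1, n - 2, …, 0)`. -/
def delta (n : ℕ) : Fin n → ℕ := fun i ↦ n - 1 - i.1

/-- `S_λ = (-1)^{n(n-1)/2} y^{λ + δ} ψ_{w_{0,n}}`. -/
def S (lam : Fin n → ℕ) : NilHecke K n :=
  (-1) ^ (n * (n - 1) / 2) * yMonomial K n (lam + delta n) * psiPerm K n (longest n)

/-- `p` is a symmetric polynomial with `S_λ ≡ p(y_1, …, y_n)` modulo `J_n`. -/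
def IsYPart (lam : Fin n → ℕ) (p : MvPolynomial (Fin n) K) : Prop :=
  p.IsSymmetric ∧ S K n lam - evalY K n p ∈ J K n

open Classical in
/-- The element `z(λ)`: the value at `y_1, …, y_n` of the symmetric polynomial `p` with
`S_λ ≡ p(y_1, …, y_n)` modulo `J_n` (the value `0` is used only if no such `p` exists). -/
def z (lam : Fin n → ℕ) : NilHecke K n :=
  if h : ∃ p, IsYPart K n lam p then evalY K n h.choose else 0

end Algebra

section Schur

variable (K : Type*) [Field K] (n : ℕ)

/-- The alternant `a_μ(x) = ∑_w (-1)^{ℓ(w)} x^{w(μ)}`, where `(-1)^{ℓ(w)}` is the sign of `w`. -/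
def alternant (μ : Fin n → ℕ) : MvPolynomial (Fin n) K :=
  ∑ w : Equiv.Perm (Fin n), (Equiv.Perm.sign w : ℤ) • ∏ i, MvPolynomial.X (w i) ^ μ i

theorem alternant_eq_det (μ : Fin n → ℕ) :
    alternant K n μ =
      (Matrix.of fun i j : Fin n ↦ (MvPolynomial.X i : MvPolynomial (Fin n) K) ^ μ j).det := by
  rw [Matrix.det_apply]
  rfl

theorem alternant_delta_dvd_vandermonde :
    alternant K n (delta n) ∣
      (Matrix.vandermonde (MvPolynomial.X : Fin n → MvPolynomial (Fin n) K)).det := by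
  have h : (Matrix.of fun i j : Fin n ↦
      (MvPolynomial.X i : MvPolynomial (Fin n) K) ^ delta n j) =
      (Matrix.vandermonde (MvPolynomial.X : Fin n → MvPolynomial (Fin n) K)).submatrix id
        Fin.revPerm := by
    ext1 i j
    simp only [Matrix.of_apply, Matrix.submatrix_apply, Matrix.vandermonde_apply, id, delta,
      Fin.revPerm_apply, Fin.val_rev]
    congr 1
    omega
  rw [alternant_eq_det, h, Matrix.det_permute']
  rcases Int.units_eq_one_or (Equiv.Perm.sign (Fin.revPerm : Equiv.Perm (Fin n))) with h | h <;>
    simp [h]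

theorem vandermonde_dvd_alternant (μ : Fin n → ℕ) :
    (Matrix.vandermonde (MvPolynomial.X : Fin n → MvPolynomial (Fin n) K)).det ∣
      alternant K n μ := by
  classical
  let P : Polynomial (MvPolynomial (Fin n) K) :=
    ∏ k : Fin n, (Polynomial.X - Polynomial.C (MvPolynomial.X k))
  have hP : P.Monic := Polynomial.monic_prod_of_monic _ _ fun k _ ↦ Polynomial.monic_X_sub_C _
  have hdeg : P.degree = n := by
    simp [P, Polynomial.degree_prod]
  have hroot (i : Fin n) : P.eval (MvPolynomial.X i) = 0 := by
    simp only [P, Polynomial.eval_prod]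
    exact Finset.prod_eq_zero (Finset.mem_univ i) (by simp)
  let C : Matrix (Fin n) (Fin n) (MvPolynomial (Fin n) K) :=
    Matrix.of fun k j ↦ ((Polynomial.X ^ μ j) %ₘ P).coeff k
  have key : (Matrix.of fun i j : Fin n ↦
      (MvPolynomial.X i : MvPolynomial (Fin n) K) ^ μ j) = Matrix.vandermonde MvPolynomial.X * C := by
    ext1 i j
    have h1 := congrArg (Polynomial.eval (MvPolynomial.X i))
      (Polynomial.modByMonic_add_div (Polynomial.X ^ μ j) P)
    rw [Polynomial.eval_add, Polynomial.eval_mul, hroot, zero_mul, add_zero, Polynomial.eval_pow,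
      Polynomial.eval_X] at h1
    have h2 : ((Polynomial.X ^ μ j) %ₘ P).degree < n :=
      hdeg ▸ Polynomial.degree_modByMonic_lt _ hP
    rw [Matrix.of_apply, ← h1, Polynomial.eval_eq_sum, Polynomial.sum_def, Matrix.mul_apply]
    simp only [Matrix.vandermonde_apply, C, Matrix.of_apply]
    rw [Fin.sum_univ_eq_sum_range (fun k ↦
      (MvPolynomial.X i : MvPolynomial (Fin n) K) ^ k * ((Polynomial.X ^ μ j) %ₘ P).coeff k)]
    refine (Finset.sum_subset (fun k hk ↦ ?_) fun k _ hk ↦ ?_).trans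
      (Finset.sum_congr rfl fun k _ ↦ mul_comm _ _)
    · rw [Finset.mem_range]
      by_contra hlt
      exact Polynomial.mem_support_iff.1 hk (Polynomial.coeff_eq_zero_of_degree_lt
        (h2.trans_le (by exact_mod_cast not_lt.1 hlt)))
    · rw [Polynomial.notMem_support_iff.1 hk, zero_mul]
  rw [alternant_eq_det, key, Matrix.det_mul]
  exact dvd_mul_right _ _

theorem alternant_delta_dvd (μ : Fin n → ℕ) : alternant K n (delta n) ∣ alternant K n μ :=
  (alternant_delta_dvd_vandermonde K n).trans (vandermonde_dvd_alternant K n μ)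

/-- The Schur polynomial `s_λ = a_{λ + δ} / a_δ`: the cofactor in `a_{λ + δ} = a_δ * s_λ`, which is
unique because `a_δ` is, up to sign, the Vandermonde product of the `x_j - x_i` and so nonzero. -/
def schurPoly (lam : Fin n → ℕ) : MvPolynomial (Fin n) K :=
  (alternant_delta_dvd K n (lam + delta n)).choose

end Schur

end NilHeckeAlg

end

/-!
Right multiplication on `H_n^{(0)} / J_n` is the polynomial representation in disguise: there `y_k`
acts on `K[x_1, …, x_n]` by multiplication by `x_k`, and `ψ_r` by the divided difference
`∂_r f = (f - s_r f) / (x_{r+1} - x_r)` (`polyRep`). This action takes `1` to `0` under `J_n` and to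
`p` under `p(y_1, …, y_n)`, so a polynomial in the `y_k` is determined by its class modulo `J_n`. In
the other direction, `f(y) ψ_r = ψ_r (s_r f)(y) + (∂_r f)(y)` shows that `f(y) ψ_{w_0}` is congruent
to `(f · ψ_{w_0})(y)` (`evalYHom_mul_word_sub_mem_J`). It remains to identify `x^{λ + δ} · ψ_{w_0}`
with `(-1)^{n(n-1)/2} s_λ`.

Write `A f` for the alternating sum of the permutations of `f`. Divided differences are self-adjoint
for the pairing `A (f g)` (`antisymmetrize_mul_demazure`), so, for a word `I` in the `ψ_r` and its
reverse `I'`, `A (x^δ (f · ψ_I)) = A ((x^δ · ψ_{I'}) f)`. If `I` has length `n (n - 1) / 2`, then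
both `f · ψ_I` and `x^δ · ψ_{I'}` are symmetric, because longer words vanish in `H_n^{(0)}`; both can
be taken out of `A`, and `a_δ (f · ψ_I)` is a multiple of `A f` by a factor that does not depend on
`f`. The choice `f = x^δ` shows that the factor is `x^δ · ψ_I`
(`IsReducedExpr.alternant_delta_mul_act`).

The vanishing of long words and the value of `x^δ · ψ_{w_0}` come from a normal form: by commutation
and braid moves alone, every word of length at least `n (n - 1) / 2` acquires a repeated letter or
becomes the word `longestWord (n - 1)` (`BraidRelations.hasRepeat_or_eq_longestWord`). The moves are
carried out for the pairs `(ψ_r, s_r)`, so that a repeated letter shows both that the word vanishes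
and that it is not reduced. A count of inversions shows that reduced expressions of `w_0` are long
enough, and `longestWord (n - 1)` takes `x^δ` to `(-1)^{n(n-1)/2}`, removing one variable with each
letter (`act_prod_X_pow_delta`).
-/

noncomputable section

namespace NilHeckeAlg

/-! ### Words in generators satisfying the braid relations -/

section Words

variable {M : Type*} [Monoid M]

/-- The value of a word in the letters `p 0, p 1, …` of a monoid. -/
def wordProd (p : ℕ → M) (L : List ℕ) : M := (L.map p).prod

theorem wordProd_append (p : ℕ → M) (L L' : List ℕ) :
    wordProd p (L ++ L') = wordProd p L * wordProd p L' := by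
  simp [wordProd]

theorem wordProd_singleton (p : ℕ → M) (r : ℕ) : wordProd p [r] = p r := by
  simp [wordProd]

/-- The first `m` letters satisfy the commutation and braid relations of the braid monoid. -/
structure BraidRelations (p : ℕ → M) (m : ℕ) : Prop where
  comm : ∀ i j, i + 1 < j → j < m → p i * p j = p j * p i
  braid : ∀ i, i + 1 < m → p i * p (i + 1) * p i = p (i + 1) * p i * p (i + 1)

/-- The word `k, k - 1, …, k - c + 1` of `c` descending letters. -/
def descWord (k : ℕ) : ℕ → List ℕ
  | 0 => []
  | c + 1 => descWord k c ++ [k - c]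

/-- The word `(0)(1, 0)(2, 1, 0)⋯(m - 1, …, 0)` of length `m (m + 1) / 2`, an expression of the
longest element. -/
def longestWord : ℕ → List ℕ
  | 0 => []
  | k + 1 => longestWord k ++ descWord k (k + 1)

theorem length_descWord (k c : ℕ) : (descWord k c).length = c := by
  induction c with
  | zero => rfl
  | succ c ih => simp [descWord, ih]

theorem lt_of_mem_descWord {k c i : ℕ} (h : i ∈ descWord k c) : i < k + 1 := by
  induction c with
  | zero => simp [descWord] at h
  | succ c ih =>
    rw [descWord, List.mem_append, List.mem_singleton] at h
    rcases h with h | h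
    · exact ih h
    · omega

theorem length_longestWord (m : ℕ) : (longestWord m).length = m * (m + 1) / 2 := by
  refine Nat.eq_div_of_mul_eq_right two_ne_zero ?_
  induction m with
  | zero => rfl
  | succ k ih =>
    rw [longestWord, List.length_append, length_descWord, mul_add, ih]
    ring

/-- `x` is the value of a word of length `l` in the first `m` letters in which some letter occurs
twice in a row. -/
def HasRepeat (p : ℕ → M) (m : ℕ) (x : M) (l : ℕ) : Prop :=
  ∃ L₁ L₂ : List ℕ, ∃ r, (∀ i ∈ L₁, i < m) ∧ (∀ i ∈ L₂, i < m) ∧ r < m ∧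
    x = wordProd p L₁ * (p r * p r) * wordProd p L₂ ∧ L₁.length + L₂.length + 2 = l

theorem HasRepeat.mul_word {p : ℕ → M} {m l : ℕ} {x : M} (h : HasRepeat p m x l) {L : List ℕ}
    (hL : ∀ i ∈ L, i < m) : HasRepeat p m (x * wordProd p L) (l + L.length) := by
  obtain ⟨L₁, L₂, r, h₁, h₂, hr, rfl, rfl⟩ := h
  refine ⟨L₁, L₂ ++ L, r, h₁, ?_, hr, ?_, ?_⟩
  · intro i hi
    rcases List.mem_append.1 hi with hi | hi
    exacts [h₂ i hi, hL i hi]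
  · rw [wordProd_append]
    simp only [mul_assoc]
  · rw [List.length_append]
    omega

variable {p : ℕ → M} {m : ℕ}

theorem BraidRelations.descWord_mul_comm (hp : BraidRelations p m) {k : ℕ} (hk : k < m) {r c : ℕ}
    (h : r + c < k) : wordProd p (descWord k c) * p r = p r * wordProd p (descWord k c) := by
  induction c with
  | zero => simp [descWord, wordProd]
  | succ c ih =>
    rw [descWord, wordProd_append, wordProd_singleton, mul_assoc,
      ← hp.comm r (k - c) (by omega) (by omega), ← mul_assoc, ih (by omega), mul_assoc]

/-- A descending word moves a letter strictly above its last letter down by one, as conjugation by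
a cycle does. -/
theorem BraidRelations.descWord_mul_shift (hp : BraidRelations p m) {r e d : ℕ}
    (hk : r + 1 + e < m) (hd : d ≤ r) :
    wordProd p (descWord (r + 1 + e) (e + 2 + d)) * p (r + 1) =
      p r * wordProd p (descWord (r + 1 + e) (e + 2 + d)) := by
  induction d with
  | zero =>
    have e₁ : r + 1 + e - e = r + 1 := by omega
    have e₂ : r + 1 + e - (e + 1) = r := by omega
    rw [add_zero, descWord, descWord, wordProd_append, wordProd_append, wordProd_singleton,
      wordProd_singleton, e₁, e₂, mul_assoc, mul_assoc, ← mul_assoc (p (r + 1)),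
      ← hp.braid r (by omega), ← mul_assoc, ← mul_assoc,
      hp.descWord_mul_comm hk (r := r) (by omega)]
    simp only [mul_assoc]
  | succ d ih =>
    rw [← add_assoc, descWord, wordProd_append, wordProd_singleton, mul_assoc,
      hp.comm _ (r + 1) (by omega) (by omega), ← mul_assoc, ih (by omega), mul_assoc]

/-- A word in the letters `0, …, k` has a repeat, or is a word in the letters `0, …, k - 1`
followed by a descending word. -/
theorem BraidRelations.exists_descWord (hp : BraidRelations p m) {k : ℕ} (hk : k < m) (L : List ℕ)
    (hL : ∀ i ∈ L, i < k + 1) :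
    HasRepeat p m (wordProd p L) L.length ∨ ∃ (L' : List ℕ) (c : ℕ), (∀ i ∈ L', i < k) ∧
      c ≤ k + 1 ∧ L'.length + c = L.length ∧
      wordProd p L = wordProd p L' * wordProd p (descWord k c) := by
  induction L using List.reverseRecOn with
  | nil => exact Or.inr ⟨[], 0, by simp, by omega, rfl, by simp [wordProd, descWord]⟩
  | append_singleton L r ih =>
    have hr : r < k + 1 := hL r (by simp)
    rw [wordProd_append, List.length_append]
    rcases ih fun i hi ↦ hL i (by simp [hi]) with h | ⟨L', c, hL', hc, hlen, hprod⟩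
    · exact Or.inl (h.mul_word fun i hi ↦ by rw [List.mem_singleton.1 hi]; omega)
    rw [hprod, wordProd_singleton, List.length_singleton, mul_assoc]
    have hsnoc : ∀ t < k, ∀ i ∈ L' ++ [t], i < k := by
      intro t ht i hi
      rcases List.mem_append.1 hi with hi | hi
      exacts [hL' i hi, List.mem_singleton.1 hi ▸ ht]
    rcases lt_or_ge (r + c) k with h | h
    · refine Or.inr ⟨L' ++ [r], c, hsnoc r (by omega), hc, by simp; omega, ?_⟩
      rw [hp.descWord_mul_comm hk h, wordProd_append, wordProd_singleton, mul_assoc]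
    rcases h.eq_or_lt with h | h
    · refine Or.inr ⟨L', c + 1, hL', by omega, by omega, ?_⟩
      rw [descWord, wordProd_append, wordProd_singleton, show k - c = r by omega]
    rcases (Nat.succ_le_of_lt h).eq_or_lt with h | h
    · obtain ⟨c, rfl⟩ : ∃ d, c = d + 1 := ⟨c - 1, by omega⟩
      refine Or.inl ⟨L' ++ descWord k c, [], r, ?_, by simp, by omega, ?_, ?_⟩
      · intro i hi
        rcases List.mem_append.1 hi with hi | hi
        exacts [(hL' i hi).trans hk, (lt_of_mem_descWord hi).trans_le hk]
      · rw [descWord, wordProd_append, wordProd_append, wordProd_singleton,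
          show k - c = r by omega]
        simp [wordProd, mul_assoc]
      · simp only [List.length_append, length_descWord, List.length_nil]
        omega
    · obtain ⟨r, rfl⟩ : ∃ t, r = t + 1 := ⟨r - 1, by omega⟩
      obtain ⟨e, rfl⟩ : ∃ e, k = r + 1 + e := ⟨k - (r + 1), by omega⟩
      obtain ⟨d, rfl⟩ : ∃ d, c = e + 2 + d := ⟨c - (e + 2), by omega⟩
      refine Or.inr ⟨L' ++ [r], e + 2 + d, hsnoc r (by omega), hc, by simp; omega, ?_⟩
      rw [hp.descWord_mul_shift hk (by omega), wordProd_append, wordProd_singleton, mul_assoc]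

/-- A word in `m` letters of length at least `m (m + 1) / 2` has a repeat or is equivalent to
`longestWord m`. -/
theorem BraidRelations.hasRepeat_or_eq_longestWord (hp : BraidRelations p m) {k : ℕ} (hk : k ≤ m)
    (L : List ℕ) (hL : ∀ i ∈ L, i < k) (hlen : (longestWord k).length ≤ L.length) :
    HasRepeat p m (wordProd p L) L.length ∨
      L.length = (longestWord k).length ∧ wordProd p L = wordProd p (longestWord k) := by
  induction k generalizing L with
  | zero =>
    obtain rfl : L = [] := List.eq_nil_iff_forall_not_mem.2 fun i hi ↦ absurd (hL i hi) (by omega)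
    exact Or.inr ⟨rfl, rfl⟩
  | succ k ih =>
    rcases hp.exists_descWord hk L hL with h | ⟨L', c, hL', hc, hl, hprod⟩
    · exact Or.inl h
    rw [longestWord, List.length_append, length_descWord] at hlen ⊢
    rw [hprod, ← hl]
    rcases ih (by omega) L' hL' (by omega) with h | ⟨h, h'⟩
    · refine Or.inl ?_
      have := h.mul_word (L := descWord k c) fun i hi ↦ (lt_of_mem_descWord hi).trans_le hk
      rwa [length_descWord] at this
    · obtain rfl : c = k + 1 := by omega
      exact Or.inr ⟨by omega, by rw [h', wordProd_append]⟩

end Words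

/-! ### Inversions of the longest element -/

section Inversions

variable {n : ℕ}

/-- The inversions of `w`. -/
def inversions (w : Equiv.Perm (Fin n)) : Finset (Fin n × Fin n) :=
  Finset.univ.filter fun q ↦ q.1 < q.2 ∧ w q.2 < w q.1

theorem mem_inversions {w : Equiv.Perm (Fin n)} {i j : Fin n} :
    (i, j) ∈ inversions w ↔ i < j ∧ w j < w i := by
  simp [inversions]

theorem simpleRefl_lt {r : Fin (n - 1)} {a b : Fin n} (h : simpleRefl r b < simpleRefl r a) :
    b < a ∨ a = lo r ∧ b = hi r := by
  simp only [simpleRefl, Equiv.swap_apply_def] at h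
  simp only [lo, hi, Fin.ext_iff, Fin.lt_def] at *
  split_ifs at h <;> simp_all <;> omega

theorem card_inversions_simpleRefl_mul_le (r : Fin (n - 1)) (w : Equiv.Perm (Fin n)) :
    (inversions (simpleRefl r * w)).card ≤ (inversions w).card + 1 := by
  refine (Finset.card_le_card (t := insert (w⁻¹ (lo r), w⁻¹ (hi r)) (inversions w)) ?_).trans
    (Finset.card_insert_le _ _)
  rintro ⟨i, j⟩ hq
  rw [mem_inversions] at hq
  rw [Finset.mem_insert, mem_inversions, Prod.mk.injEq]
  rcases simpleRefl_lt hq.2 with h | ⟨h₁, h₂⟩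
  · exact Or.inr ⟨hq.1, h⟩
  · exact Or.inl ⟨Equiv.Perm.eq_inv_iff_eq.2 h₁, Equiv.Perm.eq_inv_iff_eq.2 h₂⟩

theorem card_inversions_le_length (I : List (Fin (n - 1))) :
    (inversions (I.map simpleRefl).prod).card ≤ I.length := by
  induction I with
  | nil =>
    refine (Finset.card_eq_zero.2 (Finset.filter_eq_empty_iff.2 ?_)).le
    rintro q - ⟨h₁, h₂⟩
    exact absurd h₁ h₂.not_gt
  | cons r I ih =>
    rw [List.map_cons, List.prod_cons, List.length_cons]
    exact (card_inversions_simpleRefl_mul_le _ _).trans (Nat.succ_le_succ ih)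

theorem card_inversions_longest : (inversions (longest n)).card = n * (n - 1) / 2 := by
  have h : inversions (longest n) =
      (Finset.univ.sigma fun j : Fin n ↦ Finset.Iio j).map
        ⟨fun q ↦ (q.2, q.1), fun a b h ↦ by
          simp only [Prod.mk.injEq] at h
          exact Sigma.ext h.2 (heq_of_eq h.1)⟩ := by
    ext ⟨i, j⟩
    rw [mem_inversions]
    simp only [longest, Fin.revPerm_apply, Fin.rev_lt_rev, and_self, Finset.mem_map,
      Finset.mem_sigma, Finset.mem_univ, Finset.mem_Iio, true_and, Sigma.exists]
    refine ⟨fun h ↦ ⟨j, i, h, rfl⟩, ?_⟩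
    rintro ⟨a, b, h, e⟩
    cases e
    exact h
  rw [h, Finset.card_map, Finset.card_sigma]
  simp only [Fin.card_Iio]
  rw [Fin.sum_univ_eq_sum_range (fun k ↦ k), Finset.sum_range_id]

end Inversions

/-! ### Divided differences -/

section DividedDifference

open MvPolynomial

variable {K : Type*} [Field K] {σ : Type*}

theorem X_sub_X_ne_zero {i j : σ} (h : i ≠ j) : (X j - X i : MvPolynomial σ K) ≠ 0 :=
  sub_ne_zero.2 fun h' ↦ h (X_injective h').symm

variable [DecidableEq σ]

theorem X_sub_X_dvd (i j : σ) (f : MvPolynomial σ K) :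
    (X j - X i : MvPolynomial σ K) ∣ f - rename (Equiv.swap i j) f := by
  rw [← Ideal.mem_span_singleton, ← Ideal.Quotient.eq, ← Ideal.Quotient.mkₐ_eq_mk K]
  have hij : Ideal.Quotient.mkₐ K (Ideal.span {(X j - X i : MvPolynomial σ K)}) (X j) =
      Ideal.Quotient.mkₐ K (Ideal.span {(X j - X i : MvPolynomial σ K)}) (X i) := by
    simp only [Ideal.Quotient.mkₐ_eq_mk]
    exact Ideal.Quotient.eq.2 (Ideal.mem_span_singleton_self _)
  refine DFunLike.congr_fun (f := Ideal.Quotient.mkₐ K (Ideal.span {X j - X i}))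
    (g := (Ideal.Quotient.mkₐ K _).comp (rename (Equiv.swap i j))) ?_ f
  ext k
  rw [AlgHom.comp_apply, rename_X]
  rcases eq_or_ne k i with rfl | hi
  · rw [Equiv.swap_apply_left, hij]
  rcases eq_or_ne k j with rfl | hj
  · rw [Equiv.swap_apply_right, hij]
  · rw [Equiv.swap_apply_of_ne_of_ne hi hj]

/-- The divided difference `(f - s f) / (x_j - x_i)`, where `s` exchanges `x_i` and `x_j`. -/
def divDiff (i j : σ) (f : MvPolynomial σ K) : MvPolynomial σ K :=
  (X_sub_X_dvd i j f).choose

theorem X_sub_X_mul_divDiff (i j : σ) (f : MvPolynomial σ K) :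
    (X j - X i) * divDiff i j f = f - rename (Equiv.swap i j) f :=
  (X_sub_X_dvd i j f).choose_spec.symm

variable {i j : σ}

theorem divDiff_eq_of_mul_eq (h : i ≠ j) {f g : MvPolynomial σ K}
    (hg : (X j - X i) * g = f - rename (Equiv.swap i j) f) : divDiff i j f = g :=
  mul_left_cancel₀ (X_sub_X_ne_zero h) ((X_sub_X_mul_divDiff i j f).trans hg.symm)

/-- The divided difference as a linear map. -/
def divDiffHom (h : i ≠ j) : MvPolynomial σ K →ₗ[K] MvPolynomial σ K where
  toFun := divDiff i j
  map_add' f g := divDiff_eq_of_mul_eq h <| by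
    rw [mul_add, X_sub_X_mul_divDiff, X_sub_X_mul_divDiff, map_add]
    ring
  map_smul' c f := divDiff_eq_of_mul_eq h <| by
    rw [RingHom.id_apply, mul_smul_comm, X_sub_X_mul_divDiff, map_smul, smul_sub]

theorem divDiff_mul (h : i ≠ j) (f g : MvPolynomial σ K) :
    divDiff i j (f * g) = divDiff i j f * g + rename (Equiv.swap i j) f * divDiff i j g := by
  refine divDiff_eq_of_mul_eq h ?_
  rw [map_mul]
  linear_combination g * X_sub_X_mul_divDiff i j f +
    rename (Equiv.swap i j) f * X_sub_X_mul_divDiff i j g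

theorem divDiff_eq_zero (h : i ≠ j) {f : MvPolynomial σ K} (hf : rename (Equiv.swap i j) f = f) :
    divDiff i j f = 0 :=
  divDiff_eq_of_mul_eq h (by rw [hf, mul_zero, sub_self])

theorem rename_swap_of_divDiff_eq_zero {f : MvPolynomial σ K} (hf : divDiff i j f = 0) :
    rename (Equiv.swap i j) f = f := by
  have := X_sub_X_mul_divDiff i j f
  rw [hf, mul_zero] at this
  exact (sub_eq_zero.1 this.symm).symm

theorem divDiff_X_left (h : i ≠ j) : divDiff i j (X i : MvPolynomial σ K) = -1 :=
  divDiff_eq_of_mul_eq h (by rw [rename_X, Equiv.swap_apply_left]; ring)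

theorem divDiff_X_right (h : i ≠ j) : divDiff i j (X j : MvPolynomial σ K) = 1 :=
  divDiff_eq_of_mul_eq h (by rw [rename_X, Equiv.swap_apply_right]; ring)

theorem rename_swap_divDiff (h : i ≠ j) (f : MvPolynomial σ K) :
    rename (Equiv.swap i j) (divDiff i j f) = divDiff i j f := by
  refine (divDiff_eq_of_mul_eq h ?_).symm
  have := congrArg (rename (Equiv.swap i j)) (X_sub_X_mul_divDiff i j f)
  simp only [map_mul, map_sub, rename_X, Equiv.swap_apply_left, Equiv.swap_apply_right,
    rename_rename, ← Equiv.coe_trans, Equiv.swap_swap, Equiv.coe_refl, rename_id_apply] at this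
  linear_combination -this

theorem divDiff_divDiff (h : i ≠ j) (f : MvPolynomial σ K) : divDiff i j (divDiff i j f) = 0 :=
  divDiff_eq_zero h (rename_swap_divDiff h f)

theorem divDiff_comm {k l : σ} (hij : i ≠ j) (hkl : k ≠ l) (hik : i ≠ k) (hil : i ≠ l)
    (hjk : j ≠ k) (hjl : j ≠ l) (f : MvPolynomial σ K) :
    divDiff i j (divDiff k l f) = divDiff k l (divDiff i j f) := by
  have hs : rename (Equiv.swap i j) (rename (Equiv.swap k l) f) =
      rename (Equiv.swap k l) (rename (Equiv.swap i j) f) := by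
    rw [rename_rename, rename_rename, ← Equiv.coe_trans, ← Equiv.coe_trans]
    have h : (Equiv.swap i j).Disjoint (Equiv.swap k l) :=
      Equiv.Perm.disjoint_swap_swap (by simp [*])
    exact congrArg (fun e : Equiv.Perm σ ↦ rename e f) h.commute.eq
  have h₁ := congrArg (rename (Equiv.swap i j)) (X_sub_X_mul_divDiff k l f)
  have h₂ := congrArg (rename (Equiv.swap k l)) (X_sub_X_mul_divDiff i j f)
  simp only [map_mul, map_sub, rename_X, Equiv.swap_apply_of_ne_of_ne hik.symm hjk.symm,
    Equiv.swap_apply_of_ne_of_ne hil.symm hjl.symm] at h₁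
  simp only [map_mul, map_sub, rename_X, Equiv.swap_apply_of_ne_of_ne hik hil,
    Equiv.swap_apply_of_ne_of_ne hjk hjl] at h₂
  refine mul_left_cancel₀ (mul_ne_zero (X_sub_X_ne_zero hij) (X_sub_X_ne_zero hkl)) ?_
  linear_combination (X l - X k) * X_sub_X_mul_divDiff i j (divDiff k l f) -
    (X j - X i) * X_sub_X_mul_divDiff k l (divDiff i j f) + X_sub_X_mul_divDiff k l f
    - X_sub_X_mul_divDiff i j f - h₁ + h₂ + hs

theorem swap_braid {k : σ} (hij : i ≠ j) (hik : i ≠ k) (hjk : j ≠ k) :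
    Equiv.swap i j * (Equiv.swap j k * Equiv.swap i j) =
      Equiv.swap j k * (Equiv.swap i j * Equiv.swap j k) := by
  have h := Equiv.swap_mul_swap_mul_swap hjk.symm hik.symm
  rw [Equiv.swap_comm k j, Equiv.swap_comm j i] at h
  rw [← mul_assoc, ← mul_assoc, h, Equiv.swap_mul_swap_mul_swap hij hik, Equiv.swap_comm]

/-- Both sides of the braid relation are, up to the denominator `(x_j - x_i) (x_k - x_j) (x_k - x_i)`,
the alternating sum over the permutations of `i`, `j` and `k`. -/
theorem divDiff_braid {k : σ} (hij : i ≠ j) (hik : i ≠ k) (hjk : j ≠ k) (f : MvPolynomial σ K) :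
    divDiff i j (divDiff j k (divDiff i j f)) = divDiff j k (divDiff i j (divDiff j k f)) := by
  set s := rename (R := K) (Equiv.swap i j) with hs
  set t := rename (R := K) (Equiv.swap j k) with ht
  have si : s (X i) = X j := by simp [hs]
  have sj : s (X j) = X i := by simp [hs]
  have sk : s (X k) = X k := by simp [hs, Equiv.swap_apply_of_ne_of_ne hik.symm hjk.symm]
  have ti : t (X i) = X i := by simp [ht, Equiv.swap_apply_of_ne_of_ne hij hik]
  have tj : t (X j) = X k := by simp [ht]
  have tk : t (X k) = X j := by simp [ht]
  have hD (g : MvPolynomial σ K) : (X j - X i) * divDiff i j g = g - s g :=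
    X_sub_X_mul_divDiff i j g
  have hE (g : MvPolynomial σ K) : (X k - X j) * divDiff j k g = g - t g :=
    X_sub_X_mul_divDiff j k g
  have sD (g : MvPolynomial σ K) : s (divDiff i j g) = divDiff i j g := rename_swap_divDiff hij g
  have tE (g : MvPolynomial σ K) : t (divDiff j k g) = divDiff j k g := rename_swap_divDiff hjk g
  have hst : s (t (s f)) = t (s (t f)) := by
    simp only [hs, ht, rename_rename, ← Equiv.coe_trans]
    exact congrArg (fun e : Equiv.Perm σ ↦ rename e f) (swap_braid hij hik hjk)
  have tD := congrArg t (hD f)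
  have stD := congrArg s tD
  have sE := congrArg s (hE f)
  have tsE := congrArg t sE
  have sE' := congrArg s (hE (divDiff i j f))
  have tD' := congrArg t (hD (divDiff j k f))
  simp only [map_mul, map_sub, si, sj, sk, ti, tj, tk, sD, tE] at tD stD sE tsE sE' tD'
  refine mul_left_cancel₀ (mul_ne_zero (mul_ne_zero (X_sub_X_ne_zero hij) (X_sub_X_ne_zero hjk))
    (X_sub_X_ne_zero hik)) ?_
  linear_combination (X k - X j) * (X k - X i) * hD (divDiff j k (divDiff i j f)) +
    (X k - X i) * hE (divDiff i j f) - (X k - X j) * sE' + hD f - tD + stD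
    - ((X j - X i) * (X k - X i) * hE (divDiff i j (divDiff j k f)) +
    (X k - X i) * hD (divDiff j k f) - (X j - X i) * tD' + hE f - sE + tsE) - hst

end DividedDifference

/-! ### The polynomial representation -/

section PolynomialRepresentation

open MvPolynomial MulOpposite

variable (K : Type*) [Field K] (n : ℕ)

variable {n} in
theorem lo_ne_hi (r : Fin (n - 1)) : lo r ≠ hi r := by
  simp [lo, hi]

/-- The operator on `K[x_1, …, x_n]` through which `ψ_r` acts from the right. -/
def demazure (r : Fin (n - 1)) : MvPolynomial (Fin n) K →ₗ[K] MvPolynomial (Fin n) K :=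
  divDiffHom (lo_ne_hi r)

variable {K n} in
theorem demazure_mul (r : Fin (n - 1)) (f g : MvPolynomial (Fin n) K) :
    demazure K n r (f * g) = demazure K n r f * g + rename (simpleRefl r) f * demazure K n r g :=
  divDiff_mul (lo_ne_hi r) f g

variable {K n} in
theorem X_sub_X_mul_demazure (r : Fin (n - 1)) (f : MvPolynomial (Fin n) K) :
    (X (hi r) - X (lo r)) * demazure K n r f = f - rename (simpleRefl r) f :=
  X_sub_X_mul_divDiff _ _ _

theorem demazure_X_lo (r : Fin (n - 1)) : demazure K n r (X (lo r)) = -1 :=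
  divDiff_X_left (lo_ne_hi r)

theorem demazure_X_hi (r : Fin (n - 1)) : demazure K n r (X (hi r)) = 1 :=
  divDiff_X_right (lo_ne_hi r)

variable {K n} in
theorem demazure_eq_zero (r : Fin (n - 1)) {f : MvPolynomial (Fin n) K}
    (hf : rename (simpleRefl r) f = f) : demazure K n r f = 0 :=
  divDiff_eq_zero (lo_ne_hi r) hf

theorem demazure_X_of_ne {r : Fin (n - 1)} {k : Fin n} (h₁ : k ≠ lo r) (h₂ : k ≠ hi r) :
    demazure K n r (X k) = 0 :=
  demazure_eq_zero r (by rw [rename_X, simpleRefl, Equiv.swap_apply_of_ne_of_ne h₁ h₂])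

/-- The right action of `H_n^{(0)}` on `K[x_1, …, x_n]`, in which `y_k` acts by multiplication by
`x_k` and `ψ_r` by the divided difference. -/
def polyRep : NilHecke K n →ₐ[K] (Module.End K (MvPolynomial (Fin n) K))ᵐᵒᵖ :=
  RingQuot.liftAlgHom K ⟨FreeAlgebra.lift K (Sum.elim (fun r ↦ op (demazure K n r))
    fun k ↦ op (LinearMap.mulRight K (X k))), by
    intro a b h
    apply MulOpposite.unop_injective
    refine LinearMap.ext fun f ↦ ?_
    cases h <;>
      simp only [freePsi, freeY, map_mul, map_add, map_one, map_zero, FreeAlgebra.lift_ι_apply,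
        Sum.elim_inl, Sum.elim_inr, unop_mul, unop_add, unop_one, unop_zero, unop_op,
        Module.End.mul_apply, Module.End.one_apply, LinearMap.add_apply, LinearMap.zero_apply,
        LinearMap.mulRight_apply, demazure_mul, demazure_X_lo, demazure_X_hi]
    case psi_sq r => exact divDiff_divDiff (lo_ne_hi r) f
    case psi_comm r k h =>
      refine divDiff_comm (lo_ne_hi k) (lo_ne_hi r) ?_ ?_ ?_ ?_ f <;>
        simp only [lo, hi, ne_eq, Fin.mk.injEq] <;> omega
    case braid r t h =>
      have e : hi r = lo t := by simp [lo, hi, h]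
      have ht (g : MvPolynomial (Fin n) K) : demazure K n t g = divDiff (hi r) (hi t) g := by
        rw [e]; rfl
      rw [ht, ht f, ht]
      exact divDiff_braid (lo_ne_hi r) (by simp only [lo, hi, ne_eq, Fin.mk.injEq]; omega)
        (e ▸ lo_ne_hi t) f
    case y_comm r k => ring
    case psi_y r => linear_combination X_sub_X_mul_demazure r f
    case y_psi r => linear_combination X_sub_X_mul_demazure r f
    case psi_y_comm r k h₁ h₂ =>
      rw [demazure_X_of_ne K n h₁ h₂, mul_zero, add_zero]⟩

variable {K n}

theorem polyRep_mkHom (a : FreeAlgebra K (Fin (n - 1) ⊕ Fin n)) :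
    polyRep K n (mkHom K n a) = FreeAlgebra.lift K (Sum.elim (fun r ↦ op (demazure K n r))
      fun k ↦ op (LinearMap.mulRight K (X k))) a :=
  RingQuot.liftAlgHom_mkAlgHom_apply _ _ _ _

/-- The result `f · h` of the right action of `h` on the polynomial `f`. -/
def act (f : MvPolynomial (Fin n) K) (h : NilHecke K n) : MvPolynomial (Fin n) K :=
  (polyRep K n h).unop f

theorem act_mul (f : MvPolynomial (Fin n) K) (a b : NilHecke K n) :
    act f (a * b) = act (act f a) b := by
  simp [act]

theorem act_one (f : MvPolynomial (Fin n) K) : act f 1 = f := by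
  simp [act]

theorem act_zero (f : MvPolynomial (Fin n) K) : act f 0 = 0 := by
  simp [act]

theorem act_psi (f : MvPolynomial (Fin n) K) (r : Fin (n - 1)) :
    act f (psi K n r) = demazure K n r f := by
  rw [act, psi, polyRep_mkHom, freePsi, FreeAlgebra.lift_ι_apply]
  rfl

theorem act_y (f : MvPolynomial (Fin n) K) (k : Fin n) : act f (y K n k) = f * X k := by
  rw [act, y, polyRep_mkHom, freeY, FreeAlgebra.lift_ι_apply]
  rfl

theorem act_one_eq_zero_of_mem_J {h : NilHecke K n} (hh : h ∈ J K n) : act 1 h = 0 := by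
  have hJ : J K n ≤ LinearMap.ker ((LinearMap.applyₗ (1 : MvPolynomial (Fin n) K)).comp
      ((opLinearEquiv K).symm.toLinearMap.comp (polyRep K n).toLinearMap)) := by
    refine iSup_le fun r ↦ ?_
    rintro _ ⟨x, rfl⟩
    rw [LinearMap.mem_ker]
    change act 1 (psi K n r * x) = 0
    rw [act_mul, act_psi, demazure_eq_zero r (map_one _)]
    exact map_zero _
  exact hJ hh

end PolynomialRepresentation

/-! ### Polynomials in the `y_k` modulo `J` -/

section PolynomialPart

open MvPolynomial

variable {K : Type*} [Field K] {n : ℕ}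

theorem y_mul_comm (r k : Fin n) : y K n r * y K n k = y K n k * y K n r := by
  have := RingQuot.mkAlgHom_rel K (Rel.y_comm (K := K) r k)
  rwa [map_mul, map_mul] at this

theorem psi_mul_self (r : Fin (n - 1)) : psi K n r * psi K n r = 0 := by
  have := RingQuot.mkAlgHom_rel K (Rel.psi_sq (K := K) r)
  rwa [map_mul, map_zero] at this

theorem psi_mul_comm {r k : Fin (n - 1)} (h : k.1 + 1 < r.1) :
    psi K n r * psi K n k = psi K n k * psi K n r := by
  have := RingQuot.mkAlgHom_rel K (Rel.psi_comm (K := K) r k h)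
  rwa [map_mul, map_mul] at this

theorem psi_braid {r t : Fin (n - 1)} (h : t.1 = r.1 + 1) :
    psi K n r * psi K n t * psi K n r = psi K n t * psi K n r * psi K n t := by
  have := RingQuot.mkAlgHom_rel K (Rel.braid (K := K) r t h)
  rwa [map_mul, map_mul, map_mul, map_mul] at this

/-- The commutation of `y_k` past `ψ_r` from left to right, for all `k` at once. -/
theorem y_mul_psi (k : Fin n) (r : Fin (n - 1)) :
    y K n k * psi K n r = psi K n r * y K n (simpleRefl r k) +
      algebraMap K _ (coeff 0 (demazure K n r (X k))) := by
  rcases eq_or_ne k (lo r) with rfl | h₁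
  · have := RingQuot.mkAlgHom_rel K (Rel.psi_y (K := K) r)
    rw [map_mul, map_add, map_mul, map_one] at this
    rw [demazure_X_lo, simpleRefl, Equiv.swap_apply_left, coeff_neg, coeff_zero_one, map_neg,
      map_one]
    exact eq_add_neg_of_add_eq this.symm
  rcases eq_or_ne k (hi r) with rfl | h₂
  · have := RingQuot.mkAlgHom_rel K (Rel.y_psi (K := K) r)
    rw [map_mul, map_add, map_mul, map_one] at this
    rw [demazure_X_hi, simpleRefl, Equiv.swap_apply_right, coeff_zero_one, map_one]
    exact this
  · have := RingQuot.mkAlgHom_rel K (Rel.psi_y_comm (K := K) r k h₁ h₂)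
    rw [map_mul, map_mul] at this
    rw [demazure_X_of_ne K n h₁ h₂, simpleRefl, Equiv.swap_apply_of_ne_of_ne h₁ h₂, coeff_zero,
      map_zero, add_zero]
    exact this.symm

/-- The subalgebra generated by the `y_k`. It is commutative, so that polynomials can be evaluated
in it. -/
def yAlgebra (K : Type*) [Field K] (n : ℕ) : Subalgebra K (NilHecke K n) :=
  Algebra.adjoin K (Set.range (y K n))

instance : IsMulCommutative (yAlgebra K n) :=
  Algebra.isMulCommutative_adjoin K (by
    rintro _ ⟨r, rfl⟩ _ ⟨k, rfl⟩
    exact y_mul_comm r k)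

open scoped IsMulCommutative in
/-- Evaluation at the `y_k` as an algebra homomorphism. -/
def evalYHom (K : Type*) [Field K] (n : ℕ) : MvPolynomial (Fin n) K →ₐ[K] NilHecke K n :=
  (yAlgebra K n).val.comp
    (aeval fun k ↦ (⟨y K n k, Algebra.subset_adjoin ⟨k, rfl⟩⟩ : yAlgebra K n))

open scoped IsMulCommutative in
theorem evalYHom_X (k : Fin n) : evalYHom K n (X k) = y K n k := by
  simp [evalYHom]

theorem evalYHom_prod_X_pow (c : Fin n → ℕ) :
    evalYHom K n (∏ i, X i ^ c i) = yMonomial K n c := by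
  rw [← List.prod_ofFn, map_list_prod, List.map_ofFn, yMonomial]
  congr 2
  funext i
  rw [Function.comp_apply, map_pow, evalYHom_X]

theorem evalY_eq (f : MvPolynomial (Fin n) K) : evalY K n f = evalYHom K n f := by
  conv_rhs => rw [f.as_sum]
  rw [map_sum, evalY]
  refine Finset.sum_congr rfl fun m _ ↦ ?_
  rw [monomial_eq, Finsupp.prod_fintype _ _ fun i ↦ pow_zero _, C_mul', map_smul,
    evalYHom_prod_X_pow]

theorem act_evalYHom (f g : MvPolynomial (Fin n) K) : act f (evalYHom K n g) = f * g := by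
  induction g using MvPolynomial.induction_on generalizing f with
  | C a =>
    rw [← algebraMap_eq, AlgHom.commutes, act, AlgHom.commutes, ← Algebra.commutes a f,
      ← Algebra.smul_def]
    rfl
  | add p q hp hq =>
    rw [map_add, mul_add, ← hp, ← hq, act, map_add]
    rfl
  | mul_X p k hp => rw [map_mul, evalYHom_X, act_mul, act_y, hp, mul_assoc]

theorem demazure_X_eq_algebraMap (r : Fin (n - 1)) (k : Fin n) :
    demazure K n r (X k) = algebraMap K _ (coeff 0 (demazure K n r (X k))) := by
  rcases eq_or_ne k (lo r) with rfl | h₁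
  · simp [demazure_X_lo]
  rcases eq_or_ne k (hi r) with rfl | h₂
  · simp [demazure_X_hi]
  · simp [demazure_X_of_ne K n h₁ h₂]

/-- The defining relations between `ψ_r` and the `y_k`, extended to all polynomials in the `y_k`. -/
theorem evalYHom_mul_psi (f : MvPolynomial (Fin n) K) (r : Fin (n - 1)) :
    evalYHom K n f * psi K n r =
      psi K n r * evalYHom K n (rename (simpleRefl r) f) + evalYHom K n (demazure K n r f) := by
  induction f using MvPolynomial.induction_on with
  | C a =>
    rw [rename_C, demazure_eq_zero r (rename_C _ _), map_zero, add_zero, ← algebraMap_eq,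
      AlgHom.commutes, Algebra.commutes]
  | add p q hp hq =>
    simp only [map_add, add_mul, mul_add, hp, hq]
    abel
  | mul_X p k hp =>
    have hD : demazure K n r (p * X k) = demazure K n r p * X (simpleRefl r k) +
        p * algebraMap K _ (coeff 0 (demazure K n r (X k))) := by
      rw [mul_comm, demazure_mul, rename_X, ← demazure_X_eq_algebraMap]
      ring
    rw [hD, map_mul, map_mul, rename_X, map_mul, map_add, map_mul, map_mul, AlgHom.commutes,
      evalYHom_X, evalYHom_X, mul_assoc, y_mul_psi, mul_add, ← mul_assoc, hp]
    noncomm_ring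

theorem mul_mem_J {x : NilHecke K n} (hx : x ∈ J K n) (h : NilHecke K n) : x * h ∈ J K n := by
  have hJ : J K n ≤ (J K n).comap (LinearMap.mulRight K h) := by
    refine iSup_le fun r ↦ ?_
    rintro _ ⟨z, rfl⟩
    refine Submodule.mem_iSup_of_mem r ⟨z * h, ?_⟩
    simp [mul_assoc]
  exact hJ hx

/-- Modulo `J`, right multiplication of polynomials in the `y_k` by a word in the `ψ_r` is the
right action on polynomials. -/
theorem evalYHom_mul_word_sub_mem_J (f : MvPolynomial (Fin n) K) (I : List (Fin (n - 1))) :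
    evalYHom K n f * (I.map (psi K n)).prod -
      evalYHom K n (act f (I.map (psi K n)).prod) ∈ J K n := by
  induction I generalizing f with
  | nil => simp [act_one]
  | cons r I ih =>
    rw [List.map_cons, List.prod_cons, act_mul, act_psi, ← mul_assoc, evalYHom_mul_psi, add_mul,
      add_sub_assoc]
    refine add_mem (mul_mem_J (Submodule.mem_iSup_of_mem r ⟨_, rfl⟩) _) (ih _)

end PolynomialPart

/-! ### Words in the `ψ_r` -/

section PsiWords

open MvPolynomial

variable (K : Type*) [Field K] (n : ℕ)

/-- `ψ_r` for a natural number `r`, and `1` when `r` is out of range. -/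
def natPsi (r : ℕ) : NilHecke K n := if h : r < n - 1 then psi K n ⟨r, h⟩ else 1

/-- `s_r` for a natural number `r`, and `1` when `r` is out of range. -/
def natRefl (r : ℕ) : Equiv.Perm (Fin n) := if h : r < n - 1 then simpleRefl ⟨r, h⟩ else 1

/-- The pairs `(ψ_r, s_r)`: their words record an element of `H_n^{(0)}` together with the
permutation of which the word is an expression. -/
def psiRefl (r : ℕ) : NilHecke K n × Equiv.Perm (Fin n) := (natPsi K n r, natRefl n r)

variable {K n}

theorem natPsi_val (r : Fin (n - 1)) : natPsi K n r = psi K n r := dif_pos r.2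

theorem natRefl_val (r : Fin (n - 1)) : natRefl n r = simpleRefl r := dif_pos r.2

theorem psiRefl_braidRelations : BraidRelations (psiRefl K n) (n - 1) where
  comm i j h hj := by
    obtain ⟨i, rfl⟩ : ∃ a : Fin (n - 1), a.1 = i := ⟨⟨i, by omega⟩, rfl⟩
    obtain ⟨j, rfl⟩ : ∃ a : Fin (n - 1), a.1 = j := ⟨⟨j, by omega⟩, rfl⟩
    refine Prod.ext ?_ ?_
    · simp only [psiRefl, Prod.fst_mul, natPsi_val]
      exact (psi_mul_comm h).symm
    · simp only [psiRefl, Prod.snd_mul, natRefl_val]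
      have h : (simpleRefl i).Disjoint (simpleRefl j) := Equiv.Perm.disjoint_swap_swap (by
        simp [lo, hi]
        omega)
      exact h.commute.eq
  braid i h := by
    obtain ⟨t, ht⟩ : ∃ a : Fin (n - 1), a.1 = i + 1 := ⟨⟨i + 1, h⟩, rfl⟩
    obtain ⟨i, rfl⟩ : ∃ a : Fin (n - 1), a.1 = i := ⟨⟨i, by omega⟩, rfl⟩
    rw [← ht]
    refine Prod.ext ?_ ?_
    · simp only [psiRefl, Prod.fst_mul, natPsi_val]
      exact psi_braid ht
    · simp only [psiRefl, Prod.snd_mul, natRefl_val]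
      have e : lo t = hi i := by simp [lo, hi, ht]
      rw [simpleRefl, simpleRefl, mul_assoc, mul_assoc, e]
      exact swap_braid (lo_ne_hi i) (by simp only [lo, hi, ne_eq, Fin.mk.injEq]; omega)
        (e ▸ lo_ne_hi t)

theorem wordProd_psiRefl_map_val (I : List (Fin (n - 1))) :
    wordProd (psiRefl K n) (I.map Fin.val) =
      ((I.map (psi K n)).prod, (I.map simpleRefl).prod) := by
  induction I with
  | nil => rfl
  | cons r I ih =>
    rw [wordProd] at ih
    simp only [wordProd, List.map_cons, List.prod_cons, ih]
    rw [psiRefl, natPsi_val, natRefl_val]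
    rfl

theorem exists_map_val_eq {m : ℕ} (L : List ℕ) (hL : ∀ i ∈ L, i < m) :
    ∃ I : List (Fin m), I.map Fin.val = L := by
  lift L to List (Fin m) using hL
  exact ⟨L, rfl⟩

/-- A word with a repeat has value zero and is not reduced. -/
theorem eq_zero_and_exists_shorter_of_hasRepeat {I : List (Fin (n - 1))}
    (h : HasRepeat (psiRefl K n) (n - 1) (wordProd (psiRefl K n) (I.map Fin.val)) I.length) :
    (I.map (psi K n)).prod = 0 ∧
      ∃ I', IsExpr (I.map simpleRefl).prod I' ∧ I'.length < I.length := by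
  obtain ⟨L₁, L₂, r, h₁, h₂, hr, he, hl⟩ := h
  obtain ⟨I₁, rfl⟩ := exists_map_val_eq L₁ h₁
  obtain ⟨I₂, rfl⟩ := exists_map_val_eq L₂ h₂
  obtain ⟨r, rfl⟩ : ∃ a : Fin (n - 1), a.1 = r := ⟨⟨r, hr⟩, rfl⟩
  simp only [wordProd_psiRefl_map_val, psiRefl, natPsi_val, natRefl_val, Prod.mk_mul_mk,
    psi_mul_self, mul_zero, zero_mul, Prod.mk.injEq] at he
  refine ⟨he.1, I₁ ++ I₂, ?_, ?_⟩
  · rw [IsExpr, he.2, List.map_append, List.prod_append, simpleRefl, Equiv.swap_mul_self, mul_one]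
  · simp only [List.length_map] at hl
    rw [List.length_append]
    omega

theorem length_longestWord_pred (n : ℕ) : (longestWord (n - 1)).length = n * (n - 1) / 2 := by
  rw [length_longestWord]
  cases n with
  | zero => rfl
  | succ n => rw [Nat.add_sub_cancel, mul_comm]

theorem prod_psi_eq_zero_of_lt_length {I : List (Fin (n - 1))} (h : n * (n - 1) / 2 < I.length) :
    (I.map (psi K n)).prod = 0 := by
  have hlen : (I.map Fin.val).length = I.length := List.length_map _
  rcases (psiRefl_braidRelations (K := K) (n := n)).hasRepeat_or_eq_longestWord le_rfl (I.map Fin.val)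
    (by simp) (by rw [hlen, length_longestWord_pred]; exact h.le) with h' | ⟨h', -⟩
  · rw [hlen] at h'
    exact (eq_zero_and_exists_shorter_of_hasRepeat h').1
  · rw [hlen, length_longestWord_pred] at h'
    omega

theorem IsReducedExpr.length_longest_le {I : List (Fin (n - 1))}
    (hI : IsReducedExpr (longest n) I) : n * (n - 1) / 2 ≤ I.length := by
  rw [← card_inversions_longest, ← hI.1]
  exact card_inversions_le_length I

/-- All reduced expressions of the longest element give the same `ψ_{w_0}`, that of
`longestWord (n - 1)`. -/
theorem IsReducedExpr.prod_psi_longest {I : List (Fin (n - 1))}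
    (hI : IsReducedExpr (longest n) I) :
    I.length = n * (n - 1) / 2 ∧
      (I.map (psi K n)).prod = wordProd (natPsi K n) (longestWord (n - 1)) := by
  have hlen : (I.map Fin.val).length = I.length := List.length_map _
  rcases (psiRefl_braidRelations (K := K) (n := n)).hasRepeat_or_eq_longestWord le_rfl (I.map Fin.val)
    (by simp) (by rw [hlen, length_longestWord_pred]; exact hI.length_longest_le) with h | ⟨h, h'⟩
  · rw [hlen] at h
    obtain ⟨I', hI', hlt⟩ := (eq_zero_and_exists_shorter_of_hasRepeat h).2
    rw [hI.1] at hI'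
    exact absurd (hI.2 I' hI') hlt.not_ge
  · refine ⟨by rw [← hlen, h, length_longestWord_pred], ?_⟩
    rw [wordProd_psiRefl_map_val] at h'
    have := congrArg (MonoidHom.fst _ _) h'
    rw [wordProd, map_list_prod, List.map_map] at this
    exact this

end PsiWords

/-! ### The action of the longest word on `x^δ` -/

section Staircase

open MvPolynomial

variable {K : Type*} [Field K] {n : ℕ}

theorem demazure_prod_X_pow (r : Fin (n - 1)) {e e' : Fin n → ℕ} (h₁ : e (lo r) = e' (lo r) + 1)
    (h₂ : ∀ i, i ≠ lo r → e i = e' i) (h₃ : e' (lo r) = e' (hi r)) :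
    demazure K n r (∏ i, X i ^ e i) = -∏ i, X i ^ e' i := by
  have he : (∏ i, X i ^ e i : MvPolynomial (Fin n) K) = (∏ i, X i ^ e' i) * X (lo r) := by
    rw [← Finset.mul_prod_erase _ _ (Finset.mem_univ (lo r)),
      ← Finset.mul_prod_erase _ (fun i ↦ (X i : MvPolynomial (Fin n) K) ^ e' i)
        (Finset.mem_univ (lo r)), h₁, pow_succ,
      Finset.prod_congr rfl fun i hi ↦ by rw [h₂ i (Finset.ne_of_mem_erase hi)]]
    ring
  have hs : rename (simpleRefl r) (∏ i, X i ^ e' i : MvPolynomial (Fin n) K) =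
      ∏ i, X i ^ e' i := by
    rw [map_prod, ← Equiv.prod_comp (simpleRefl r) fun i ↦ (X i : MvPolynomial (Fin n) K) ^ e' i]
    refine Finset.prod_congr rfl fun i _ ↦ ?_
    rw [map_pow, rename_X]
    congr 1
    rcases eq_or_ne i (lo r) with rfl | h
    · rw [simpleRefl, Equiv.swap_apply_left, h₃]
    rcases eq_or_ne i (hi r) with rfl | h'
    · rw [simpleRefl, Equiv.swap_apply_right, h₃]
    · rw [simpleRefl, Equiv.swap_apply_of_ne_of_ne h h']
  rw [he, demazure_mul, demazure_eq_zero r hs, hs, demazure_X_lo]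
  ring

theorem act_neg_one_pow_mul (c : ℕ) (f : MvPolynomial (Fin n) K) (h : NilHecke K n) :
    act ((-1) ^ c * f) h = (-1) ^ c * act f h := by
  rcases neg_one_pow_eq_or (MvPolynomial (Fin n) K) c with hc | hc <;> simp [hc, act]

/-- The exponents of the monomial into which `longestWord k` followed by the first `c` letters of
`descWord k (k + 1)` takes `x^δ`, up to sign. -/
def stairExp (n k c : ℕ) (i : Fin n) : ℕ :=
  if i.1 + c ≤ k then n - 1 - k else if i.1 ≤ k then n - 2 - k else n - 1 - i.1

theorem act_descWord (k : ℕ) (hk : k < n - 1) (c : ℕ) (hc : c ≤ k + 1) :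
    act (∏ i, X i ^ stairExp n k 0 i : MvPolynomial (Fin n) K)
      (wordProd (natPsi K n) (descWord k c)) = (-1) ^ c * ∏ i, X i ^ stairExp n k c i := by
  induction c with
  | zero => rw [descWord, wordProd, List.map_nil, List.prod_nil, act_one, pow_zero, one_mul]
  | succ c ih =>
    obtain ⟨r, hr⟩ : ∃ a : Fin (n - 1), a.1 = k - c := ⟨⟨k - c, by omega⟩, rfl⟩
    rw [descWord, wordProd_append, wordProd_singleton, act_mul, ih (by omega),
      act_neg_one_pow_mul, ← hr, natPsi_val, act_psi,
      demazure_prod_X_pow r (e' := stairExp n k (c + 1)), pow_succ]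
    · ring
    · simp only [stairExp, lo, hr]
      split_ifs <;> omega
    · intro i hi
      have hi' : i.1 ≠ k - c := fun h ↦ hi (Fin.ext (h.trans hr.symm))
      simp only [stairExp]
      split_ifs <;> omega
    · simp only [stairExp, lo, hi, hr]
      split_ifs <;> omega

theorem act_longestWord (k : ℕ) (hk : k ≤ n - 1) :
    act (∏ i, X i ^ delta n i : MvPolynomial (Fin n) K) (wordProd (natPsi K n) (longestWord k)) =
      (-1) ^ (longestWord k).length * ∏ i, X i ^ stairExp n k 0 i := by
  induction k with
  | zero =>
    rw [longestWord, wordProd, List.map_nil, List.prod_nil, act_one, List.length_nil, pow_zero,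
      one_mul]
    refine Finset.prod_congr rfl fun i _ ↦ ?_
    congr 1
    simp only [stairExp, delta]
    split_ifs <;> omega
  | succ k ih =>
    rw [longestWord, wordProd_append, act_mul, ih (by omega), act_neg_one_pow_mul,
      act_descWord k (by omega) _ le_rfl, List.length_append, length_descWord, pow_add, mul_assoc]
    have h (i : Fin n) : stairExp n k (k + 1) i = stairExp n (k + 1) 0 i := by
      simp only [stairExp]
      split_ifs <;> omega
    simp only [h]
    ring

theorem act_prod_X_pow_delta :
    act (∏ i, X i ^ delta n i : MvPolynomial (Fin n) K)
      (wordProd (natPsi K n) (longestWord (n - 1))) = (-1) ^ (n * (n - 1) / 2) := by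
  rw [act_longestWord (n - 1) le_rfl, length_longestWord_pred, Finset.prod_eq_one, mul_one]
  intro i _
  have : stairExp n (n - 1) 0 i = 0 := by
    simp only [stairExp]
    split_ifs <;> omega
  rw [this, pow_zero]

end Staircase

/-! ### Antisymmetrization -/

section Antisymmetrization

open MvPolynomial

variable {K : Type*} [Field K] {n : ℕ}

/-- The alternating sum `∑_w (-1)^{ℓ(w)} w(f)` of the permutations of a polynomial. -/
def antisymmetrize (f : MvPolynomial (Fin n) K) : MvPolynomial (Fin n) K :=
  ∑ w : Equiv.Perm (Fin n), (Equiv.Perm.sign w : ℤ) • rename w f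

theorem alternant_eq_antisymmetrize (μ : Fin n → ℕ) :
    alternant K n μ = antisymmetrize (∏ i, X i ^ μ i) := by
  refine Finset.sum_congr rfl fun w _ ↦ ?_
  simp only [map_prod, map_pow, rename_X]

theorem antisymmetrize_mul_of_isSymmetric (f : MvPolynomial (Fin n) K)
    {p : MvPolynomial (Fin n) K} (hp : p.IsSymmetric) :
    antisymmetrize (f * p) = antisymmetrize f * p := by
  rw [antisymmetrize, antisymmetrize, Finset.sum_mul]
  refine Finset.sum_congr rfl fun w _ ↦ ?_
  rw [map_mul, hp w, smul_mul_assoc]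

theorem antisymmetrize_sub (f g : MvPolynomial (Fin n) K) :
    antisymmetrize (f - g) = antisymmetrize f - antisymmetrize g := by
  simp only [antisymmetrize, map_sub, smul_sub, Finset.sum_sub_distrib]

/-- The summands for `w` and `w s_r` cancel, so that the characteristic of `K` plays no role. -/
theorem antisymmetrize_eq_zero (r : Fin (n - 1)) {f : MvPolynomial (Fin n) K}
    (hf : rename (simpleRefl r) f = f) : antisymmetrize f = 0 := by
  refine Finset.sum_involution (fun w _ ↦ w * simpleRefl r) ?_ ?_ ?_ ?_
  · intro w _
    have h : rename (w * simpleRefl r) f = rename w f := by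
      rw [Equiv.Perm.coe_mul, ← rename_rename, hf]
    rw [h, Equiv.Perm.sign_mul, simpleRefl, Equiv.Perm.sign_swap (lo_ne_hi r)]
    simp
  · intro w _ _ h
    exact lo_ne_hi r (Equiv.swap_eq_one_iff.1 (mul_eq_left.1 h))
  · intro w _
    exact Finset.mem_univ _
  · intro w _
    rw [mul_assoc, simpleRefl, Equiv.swap_mul_self, mul_one]

/-- Divided differences are self-adjoint for the pairing `(f, g) ↦ antisymmetrize (f * g)`. -/
theorem antisymmetrize_mul_demazure (r : Fin (n - 1)) (f g : MvPolynomial (Fin n) K) :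
    antisymmetrize (g * demazure K n r f) = antisymmetrize (demazure K n r g * f) := by
  rw [← sub_eq_zero, ← antisymmetrize_sub]
  refine antisymmetrize_eq_zero r (mul_left_cancel₀ (X_sub_X_ne_zero (lo_ne_hi r)) ?_)
  have hs (h : MvPolynomial (Fin n) K) :
      rename (simpleRefl r) (demazure K n r h) = demazure K n r h :=
    rename_swap_divDiff (lo_ne_hi r) h
  rw [map_sub, map_mul, map_mul, hs, hs]
  linear_combination (rename (simpleRefl r) g - g) * X_sub_X_mul_demazure r f -
    (rename (simpleRefl r) f - f) * X_sub_X_mul_demazure r g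

theorem antisymmetrize_mul_act (I : List (Fin (n - 1))) (f g : MvPolynomial (Fin n) K) :
    antisymmetrize (g * act f (I.map (psi K n)).prod) =
      antisymmetrize (act g (I.reverse.map (psi K n)).prod * f) := by
  induction I generalizing f with
  | nil => simp [act_one]
  | cons r I ih =>
    rw [List.map_cons, List.prod_cons, act_mul, act_psi, ih, antisymmetrize_mul_demazure,
      List.reverse_cons, List.map_append, List.prod_append, act_mul, List.map_singleton,
      List.prod_singleton, act_psi]

/-- All `ψ_r` annihilate the result, since words of more than `n (n - 1) / 2` letters vanish. -/
theorem isSymmetric_act {I : List (Fin (n - 1))} (hI : I.length = n * (n - 1) / 2)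
    (f : MvPolynomial (Fin n) K) : (act f (I.map (psi K n)).prod).IsSymmetric := by
  have hs (r : Fin (n - 1)) : rename (simpleRefl r) (act f (I.map (psi K n)).prod) =
      act f (I.map (psi K n)).prod := by
    refine rename_swap_of_divDiff_eq_zero ?_
    have h : ((I ++ [r]).map (psi K n)).prod = 0 := prod_psi_eq_zero_of_lt_length (by simp [hI])
    rw [List.map_append, List.prod_append, List.map_singleton, List.prod_singleton] at h
    change demazure K n r _ = 0
    rw [← act_psi, ← act_mul, h, act_zero]
  intro w
  obtain ⟨I', rfl⟩ := exists_isExpr w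
  induction I' with
  | nil => exact rename_id_apply _
  | cons r I' ih =>
    rw [List.map_cons, List.prod_cons, Equiv.Perm.coe_mul, ← rename_rename, ih, hs]

theorem alternant_delta_ne_zero : alternant K n (delta n) ≠ 0 :=
  ne_zero_of_dvd_ne_zero (Matrix.det_vandermonde_ne_zero_iff.2 (X_injective (R := K)))
    (alternant_delta_dvd_vandermonde K n)

/-- The action of `ψ_{w_0}` is the quotient of the antisymmetrization by `a_δ`, up to sign. -/
theorem IsReducedExpr.alternant_delta_mul_act {I : List (Fin (n - 1))}
    (hI : IsReducedExpr (longest n) I) (f : MvPolynomial (Fin n) K) :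
    alternant K n (delta n) * act f (I.map (psi K n)).prod =
      (-1) ^ (n * (n - 1) / 2) * antisymmetrize f := by
  obtain ⟨hlen, hprod⟩ := hI.prod_psi_longest (K := K)
  -- The factor is independent of `f`, so that `f = x^δ` determines it.
  have key (f : MvPolynomial (Fin n) K) :
      alternant K n (delta n) * act f (I.map (psi K n)).prod =
        act (∏ i, X i ^ delta n i) (I.reverse.map (psi K n)).prod * antisymmetrize f := by
    rw [alternant_eq_antisymmetrize, ← antisymmetrize_mul_of_isSymmetric _ (isSymmetric_act hlen f),
      antisymmetrize_mul_act, mul_comm, antisymmetrize_mul_of_isSymmetric _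
        (isSymmetric_act (by rw [List.length_reverse, hlen]) _), mul_comm]
  have hdelta := key (∏ i, X i ^ delta n i)
  rw [← alternant_eq_antisymmetrize, mul_comm, hprod, act_prod_X_pow_delta] at hdelta
  rw [key, ← mul_right_cancel₀ alternant_delta_ne_zero hdelta]

end Antisymmetrization

/-! ### Schur polynomials -/

section SchurPolynomials

open MvPolynomial

variable {K : Type*} [Field K] {n : ℕ}

theorem alternant_delta_mul_schurPoly (lam : Fin n → ℕ) :
    alternant K n (delta n) * schurPoly K n lam = alternant K n (lam + delta n) :=
  (alternant_delta_dvd K n (lam + delta n)).choose_spec.symm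

theorem IsReducedExpr.schurPoly_eq_act {I : List (Fin (n - 1))}
    (hI : IsReducedExpr (longest n) I) (lam : Fin n → ℕ) :
    (-1) ^ (n * (n - 1) / 2) * schurPoly K n lam =
      act (∏ i, X i ^ (lam + delta n) i) (I.map (psi K n)).prod := by
  refine mul_left_cancel₀ (alternant_delta_ne_zero (K := K) (n := n)) ?_
  rw [hI.alternant_delta_mul_act, ← alternant_eq_antisymmetrize, ← alternant_delta_mul_schurPoly]
  ring

theorem isSymmetric_neg_one_pow_mul_iff (c : ℕ) (p : MvPolynomial (Fin n) K) :
    ((-1) ^ c * p).IsSymmetric ↔ p.IsSymmetric := by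
  rcases neg_one_pow_eq_or (MvPolynomial (Fin n) K) c with hc | hc <;>
    simp [hc, IsSymmetric]

theorem isYPart_schurPoly (lam : Fin n → ℕ) : IsYPart K n lam (schurPoly K n lam) := by
  have hI : IsReducedExpr (longest n) (exists_isReducedExpr (longest n)).choose :=
    (exists_isReducedExpr (longest n)).choose_spec
  have hact := hI.schurPoly_eq_act (K := K) lam
  constructor
  · rw [← isSymmetric_neg_one_pow_mul_iff (n * (n - 1) / 2), hact]
    exact isSymmetric_act (hI.prod_psi_longest (K := K)).1 _
  · have h := evalYHom_mul_word_sub_mem_J (∏ i, X i ^ (lam + delta n) i)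
      (exists_isReducedExpr (longest n)).choose (K := K)
    rw [← hact, evalYHom_prod_X_pow, map_mul, map_pow, map_neg, map_one, ← evalY_eq] at h
    change _ * _ * psiPerm K n (longest n) - _ ∈ _
    rcases neg_one_pow_eq_or (NilHecke K n) (n * (n - 1) / 2) with hc | hc
    · rw [hc, one_mul] at h ⊢
      exact h
    · rw [hc, neg_one_mul] at h ⊢
      convert neg_mem h using 1
      rw [psiPerm]
      noncomm_ring

theorem IsYPart.unique {lam : Fin n → ℕ} {p q : MvPolynomial (Fin n) K} (hp : IsYPart K n lam p)
    (hq : IsYPart K n lam q) : p = q := by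
  have h := act_one_eq_zero_of_mem_J (sub_mem hq.2 hp.2)
  rw [sub_sub_sub_cancel_left, evalY_eq, evalY_eq, ← map_sub, act_evalYHom, one_mul] at h
  exact sub_eq_zero.1 h

end SchurPolynomials

end NilHeckeAlg

end

theorem theorem2p14 (K : Type*) [Field K] (n : ℕ) (lam : Fin n → ℕ) (hlam : Antitone lam) :
    (∃! p : MvPolynomial (Fin n) K, NilHeckeAlg.IsYPart K n lam p) ∧
      NilHeckeAlg.z K n lam = NilHeckeAlg.evalY K n (NilHeckeAlg.schurPoly K n lam) := by
  have hs := NilHeckeAlg.isYPart_schurPoly (K := K) lam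
  have h : ∃ p, NilHeckeAlg.IsYPart K n lam p := ⟨_, hs⟩
  refine ⟨⟨_, hs, fun p hp ↦ hp.unique hs⟩, ?_⟩
  rw [NilHeckeAlg.z, dif_pos h, h.choose_spec.unique hs]
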